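/- All complexes are finite abstract simplicial complexes, with the empty set regarded as the face of dimension $-1$; a $d$-face is a face with $d+1$ vertices. A $d$-path in $K$ is a sequence of distinct $d$-faces $F_1,\dots,F_m$ such that $F_a\cap F_b$ is a $(d-1)$-face of $K$ if and only if $|a-b|=1$; $K$ is $d$-path connected if any two $d$-faces are the first and the last member of a $d$-path. $K$ is acyclic if its reduced homology with real coefficients vanishes in all dimensions $\ge -1$. Given an orientation of $K$, the $i$-th incidence signed graph $B_i(K)$ is the bipartite graph on the $i$-faces and the $(i+1)$-faces of $K$ in which an $i$-face $F$ and an $(i+1)$-face $G$ are adjacent iff $F\subset G$, the sign of this edge being the coefficient $\pm1$ of $[F]$ in $\partial[G]$; it is balanced if the product of the edge signs along every cycle is $+1$. An $i$-wedge sum of complexes $K$ and $L$ with disjoint vertex sets is obtained from $K\cup L$ by identifying an $i$-face $F_1$ of $K$ with an $i$-face $F_2$ of $L$ along a bijection between their vertices. Let $i\ge 0$ be an integer. Let $K_0$ be an $(i+1)$-simplex (with all its faces) and, for $p\ge 1$, let $K_p$ be an $i$-wedge sum of $K_{p-1}$ and an $(i+1)$-simplex, along any $i$-faces and any bijection of their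 vertices. Then every such $K_p$ is a finite complex that is $(i+1)$-path connected and acyclic, and $B_i(K_p)$ is balanced for every orientation of $K_p$. Moreover, such complexes $K_p$ exist for all $p\ge 0$ and can be chosen pairwise non-isomorphic; in particular there are, up to isomorphism, infinitely many $(i+1)$-path connected acyclic complexes $K$ with $B_i(K)$ balanced. -/

import Mathlib

namespace PreAbstractSimplicialComplex

variable {V : Type*}

/-! ### Faces.  Mathlib's complexes list the nonempty faces only; the empty simplex, of
dimension `-1`, is added here.  A face of dimension `d` has `d + 1` vertices, and families of
faces are indexed by the number `n = d + 1` of vertices. -/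

/-- All faces of `K`, the empty simplex included. -/
def allFaces (K : PreAbstractSimplicialComplex V) : Set (Finset V) := insert ∅ K.faces

/-- The faces of `K` with exactly `n` vertices, that is, the `(n - 1)`-faces. -/
def facesOfCard (K : PreAbstractSimplicialComplex V) (n : ℕ) : Set (Finset V) :=
  {s | s ∈ K.allFaces ∧ s.card = n}

/-- The vertex set of `K` (its `0`-faces). -/
def vertexSet (K : PreAbstractSimplicialComplex V) : Set V := {v | {v} ∈ K.faces}

/-- `K` and `L` are isomorphic: a bijection between the vertex sets carries faces to faces, in
both directions. -/
def Isomorphic {W : Type*} (K : PreAbstractSimplicialComplex V)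
    (L : PreAbstractSimplicialComplex W) : Prop :=
  ∃ e : K.vertexSet ≃ L.vertexSet, ∀ s : Finset K.vertexSet,
    s.map (Function.Embedding.subtype _) ∈ K.faces ↔
      (s.map e.toEmbedding).map (Function.Embedding.subtype _) ∈ L.faces

/-! ### Paths of faces -/

open Classical in
/-- A `d`-path: a sequence of distinct `d`-faces such that two of them meet in a
`(d - 1)`-face exactly when they are consecutive. -/
def IsFacePath (K : PreAbstractSimplicialComplex V) (d : ℕ) {m : ℕ}
    (P : Fin m → Finset V) : Prop :=
  (∀ a, P a ∈ K.facesOfCard (d + 1)) ∧ Function.Injective P ∧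
    ∀ a b : Fin m, P a ∩ P b ∈ K.facesOfCard d ↔
      ((a : ℕ) + 1 = (b : ℕ) ∨ (b : ℕ) + 1 = (a : ℕ))

/-- `K` is `d`-path connected: any two `d`-faces are joined by a `d`-path. -/
def FacePathConnected (K : PreAbstractSimplicialComplex V) (d : ℕ) : Prop :=
  ∀ F ∈ K.facesOfCard (d + 1), ∀ G ∈ K.facesOfCard (d + 1),
    ∃ (m : ℕ) (P : Fin (m + 1) → Finset V),
      K.IsFacePath d P ∧ P 0 = F ∧ P (Fin.last m) = G

/-! ### Orderings of faces -/

/-- The ordering of the vertices obtained from `w` by the permutation `π` of the positions. -/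
def permute {n : ℕ} (w : Fin n ↪ V) (π : Equiv.Perm (Fin n)) : Fin n ↪ V :=
  π.toEmbedding.trans w

/-- The ordering obtained from `w` by omitting its `j`-th vertex. -/
def dropVertex {n : ℕ} (w : Fin (n + 1) ↪ V) (j : Fin (n + 1)) : Fin n ↪ V :=
  j.succAboveEmb.trans w

lemma map_permute {n : ℕ} (w : Fin n ↪ V) (π : Equiv.Perm (Fin n)) :
    Finset.univ.map (permute w π) = Finset.univ.map w := by
  ext v
  simp only [permute, Finset.mem_map, Finset.mem_univ, true_and]
  exact ⟨fun ⟨a, h⟩ => ⟨π a, h⟩, fun ⟨a, h⟩ => ⟨π.symm a, by simpa using h⟩⟩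

/-- An ordered face of `K` with `n` vertices: an injective list of vertices spanning a face. -/
def OrderedFace (K : PreAbstractSimplicialComplex V) (n : ℕ) : Type _ :=
  {w : Fin n ↪ V // Finset.univ.map w ∈ K.allFaces}

variable {K : PreAbstractSimplicialComplex V}

/-- Reorder an ordered face. -/
def OrderedFace.permute {n : ℕ} (w : K.OrderedFace n) (π : Equiv.Perm (Fin n)) :
    K.OrderedFace n :=
  ⟨PreAbstractSimplicialComplex.permute w.1 π, by rw [map_permute]; exact w.2⟩

/-- Omit the `j`-th vertex of an ordered face. -/
def OrderedFace.dropVertex {n : ℕ} (w : K.OrderedFace (n + 1)) (j : Fin (n + 1)) :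
    K.OrderedFace n :=
  ⟨PreAbstractSimplicialComplex.dropVertex w.1 j, by
    rcases w with ⟨w, hw⟩
    rcases hw with hw | hw
    · rw [Finset.map_eq_empty] at hw
      exact absurd hw Finset.univ_nonempty.ne_empty
    · rcases Finset.eq_empty_or_nonempty
        (Finset.univ.map (PreAbstractSimplicialComplex.dropVertex w j)) with h | h
      · exact Or.inl h
      · refine Or.inr ((K.isRelLowerSet_faces hw).2 ?_ h)
        intro v hv
        obtain ⟨a, -, rfl⟩ := Finset.mem_map.1 hv
        exact Finset.mem_map.2 ⟨j.succAbove a, Finset.mem_univ _, rfl⟩⟩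

/-! ### Chains, boundary, reduced homology -/

/-- The relations between ordered faces: an even reordering gives the same oriented face, an odd
one gives its negative. -/
noncomputable def orientationRelations (K : PreAbstractSimplicialComplex V) (n : ℕ) :
    Submodule ℝ (K.OrderedFace n →₀ ℝ) :=
  Submodule.span ℝ {c | ∃ (w : K.OrderedFace n) (π : Equiv.Perm (Fin n)),
    c = Finsupp.single (w.permute π) 1 - Finsupp.single w (((Equiv.Perm.sign π : ℤˣ) : ℤ) : ℝ)}

/-- The group `C_{n-1}(K, ℝ)` of chains on the oriented `(n - 1)`-faces. -/
abbrev Chain (K : PreAbstractSimplicialComplex V) (n : ℕ) : Type _ :=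
  (K.OrderedFace n →₀ ℝ) ⧸ K.orientationRelations n

/-- The oriented face given by an ordered face. -/
noncomputable def OrderedFace.toChain {n : ℕ} (w : K.OrderedFace n) : K.Chain n :=
  (K.orientationRelations n).mkQ (Finsupp.single w 1)

lemma OrderedFace.toChain_permute {n : ℕ} (w : K.OrderedFace n) (π : Equiv.Perm (Fin n)) :
    (w.permute π).toChain = (((Equiv.Perm.sign π : ℤˣ) : ℤ) : ℝ) • w.toChain := by
  unfold OrderedFace.toChain
  rw [← map_smul, ← sub_eq_zero, ← map_sub, Finsupp.smul_single, smul_eq_mul, mul_one,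
    Submodule.mkQ_apply, Submodule.Quotient.mk_eq_zero]
  exact Submodule.subset_span ⟨w, π, rfl⟩

/-- `[v₀, …, vₙ] ↦ ∑ⱼ (-1)ʲ [v₀, …, v̂ⱼ, …, vₙ]` on ordered faces. -/
noncomputable def preBoundary (K : PreAbstractSimplicialComplex V) (n : ℕ) :
    (K.OrderedFace (n + 1) →₀ ℝ) →ₗ[ℝ] K.Chain n :=
  Finsupp.linearCombination ℝ fun w => ∑ j : Fin (n + 1), (-1 : ℝ) ^ (j : ℕ) • (w.dropVertex j).toChain

/-- Omitting the `j`-th vertex after the reordering `π` amounts to omitting the `π j`-th one and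
reordering the rest. -/
lemma exists_perm_drop {n : ℕ} (π : Equiv.Perm (Fin (n + 1))) (j : Fin (n + 1)) :
    ∃ ρ : Equiv.Perm (Fin n), (∀ k, π (j.succAbove k) = (π j).succAbove (ρ k)) ∧
      (-1 : ℝ) ^ (j : ℕ) * (((Equiv.Perm.sign ρ : ℤˣ) : ℤ) : ℝ) =
        (((Equiv.Perm.sign π : ℤˣ) : ℤ) : ℝ) * (-1 : ℝ) ^ ((π j : Fin (n + 1)) : ℕ) := by
  set τ : Equiv.Perm (Fin (n + 1)) := (π j).cycleRange * π * j.cycleRange⁻¹ with hτ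
  have h0 : τ 0 = 0 := by
    simp [hτ, Equiv.Perm.mul_apply, Equiv.Perm.inv_def, Fin.cycleRange_symm_zero]
  obtain ⟨⟨p, ρ⟩, hρ⟩ := Equiv.Perm.decomposeFin.symm.surjective τ
  have hp : p = 0 := by
    have := Equiv.Perm.decomposeFin_symm_apply_zero p ρ
    rw [hρ, h0] at this
    exact this.symm
  subst hp
  refine ⟨ρ, fun k => ?_, ?_⟩
  · have h1 := Equiv.Perm.decomposeFin_symm_apply_succ ρ 0 k
    rw [hρ] at h1
    simp only [hτ, Equiv.Perm.mul_apply, Equiv.Perm.inv_def, Fin.cycleRange_symm_succ,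
      Equiv.swap_self, Equiv.refl_apply] at h1
    rw [← Fin.cycleRange_symm_succ (π j), ← h1, Equiv.symm_apply_apply]
  · have h2 := Equiv.Perm.decomposeFin.symm_sign 0 ρ
    rw [hρ] at h2
    simp only [if_true, one_mul] at h2
    rw [← h2, hτ]
    simp only [Equiv.Perm.sign_mul, Equiv.Perm.sign_inv, Fin.sign_cycleRange]
    push_cast
    have : ((-1 : ℝ) ^ (j : ℕ)) * (-1) ^ (j : ℕ) = 1 := by
      rw [← mul_pow]; simp
    linear_combination ((-1 : ℝ) ^ ((π j : Fin (n + 1)) : ℕ) *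
      (((Equiv.Perm.sign π : ℤˣ) : ℤ) : ℝ)) * this

lemma orientationRelations_le_ker (K : PreAbstractSimplicialComplex V) (n : ℕ) :
    K.orientationRelations (n + 1) ≤ LinearMap.ker (K.preBoundary n) := by
  refine Submodule.span_le.2 ?_
  rintro _ ⟨w, π, rfl⟩
  simp only [SetLike.mem_coe, LinearMap.mem_ker, map_sub, preBoundary,
    Finsupp.linearCombination_single, one_smul, sub_eq_zero, Finset.smul_sum]
  rw [← Equiv.sum_comp π (fun j => (((Equiv.Perm.sign π : ℤˣ) : ℤ) : ℝ) •
    (-1 : ℝ) ^ (j : ℕ) • (w.dropVertex j).toChain)]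
  refine Finset.sum_congr rfl fun j _ => ?_
  obtain ⟨ρ, h1, h2⟩ := exists_perm_drop π j
  have h3 : (w.permute π).dropVertex j = (w.dropVertex (π j)).permute ρ := by
    apply Subtype.ext
    apply DFunLike.ext
    intro k
    exact congrArg w.1 (h1 k)
  rw [h3, OrderedFace.toChain_permute, smul_smul, smul_smul, h2]

/-- The boundary map `∂ : C_n(K, ℝ) → C_{n-1}(K, ℝ)`; for `n = 0` it is the augmentation
`[v] ↦ ∅`. -/
noncomputable def boundary (K : PreAbstractSimplicialComplex V) (n : ℕ) :
    K.Chain (n + 1) →ₗ[ℝ] K.Chain n :=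
  (K.orientationRelations (n + 1)).liftQ (K.preBoundary n) (K.orientationRelations_le_ker n)

/-- The cycles among the chains on faces with `n` vertices; in dimension `-1` (`n = 0`) every
chain is a cycle. -/
noncomputable def cycles (K : PreAbstractSimplicialComplex V) :
    ∀ n : ℕ, Submodule ℝ (K.Chain n)
  | 0 => ⊤
  | n + 1 => LinearMap.ker (K.boundary n)

/-- The reduced homology group of `K` in dimension `n - 1`, `n ≥ 0`. -/
abbrev ReducedHomology (K : PreAbstractSimplicialComplex V) (n : ℕ) : Type _ :=
  K.cycles n ⧸ (LinearMap.range (K.boundary n)).submoduleOf (K.cycles n)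

/-- `K` is acyclic: its reduced homology vanishes in all dimensions `≥ -1`. -/
def IsAcyclic (K : PreAbstractSimplicialComplex V) : Prop :=
  ∀ n : ℕ, Subsingleton (K.ReducedHomology n)

/-! ### The incidence signed graph -/

/-- An orientation of `K`: every face is given by an ordering of its vertices. -/
structure FaceOrientation (K : PreAbstractSimplicialComplex V) where
  /-- the chosen ordering of a face with `n` vertices -/
  order : ∀ n : ℕ, K.facesOfCard n → (Fin n ↪ V)
  map_order : ∀ (n : ℕ) (F : K.facesOfCard n), Finset.univ.map (order n F) = F.1

open Classical in
/-- The sign of the permutation taking the ordering `w` to the ordering `w'`, and `0` if they do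
not order the same set. -/
noncomputable def orderingSign {n : ℕ} (w w' : Fin n ↪ V) : ℤ :=
  ∑ π : Equiv.Perm (Fin n), if w' = permute w π then ((Equiv.Perm.sign π : ℤˣ) : ℤ) else 0

/-- `sgn([F], ∂[G])`: the coefficient of the oriented face `w = [F]` in the boundary
`∑ⱼ (-1)ʲ [v₀, …, v̂ⱼ, …, vₙ]` of `w' = [G] = [v₀, …, vₙ]`. -/
noncomputable def incidenceSign {n : ℕ} (w : Fin n ↪ V) (w' : Fin (n + 1) ↪ V) : ℤ :=
  ∑ j : Fin (n + 1), (-1 : ℤ) ^ (j : ℕ) * orderingSign w (dropVertex w' j)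

lemma orderingSign_eq_zero {n : ℕ} {w w' : Fin n ↪ V}
    (h : Finset.univ.map w' ≠ Finset.univ.map w) : orderingSign w w' = 0 := by
  refine Finset.sum_eq_zero fun π _ => if_neg ?_
  rintro rfl
  exact h (map_permute w π)

lemma orderingSign_permute {n : ℕ} (w : Fin n ↪ V) (π : Equiv.Perm (Fin n)) :
    orderingSign w (permute w π) = ((Equiv.Perm.sign π : ℤˣ) : ℤ) := by
  unfold orderingSign
  rw [Finset.sum_eq_single π]
  · simp
  · intro ρ _ hne
    refine if_neg fun h => hne ?_
    ext k
    exact congrArg Fin.val (w.injective (DFunLike.congr_fun h k)).symm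
  · simp

lemma exists_eq_permute {n : ℕ} {w w' : Fin n ↪ V}
    (h : Finset.univ.map w' = Finset.univ.map w) : ∃ π, w' = permute w π := by
  have hk : ∀ k, ∃ a, w a = w' k := fun k => by
    have : w' k ∈ Finset.univ.map w := h ▸ Finset.mem_map.2 ⟨k, Finset.mem_univ _, rfl⟩
    simpa using this
  choose f hf using hk
  have hinj : Function.Injective f := fun a b hab => w'.injective (by rw [← hf, ← hf, hab])
  refine ⟨Equiv.ofBijective f (Finite.injective_iff_bijective.1 hinj), ?_⟩
  ext k
  exact (hf k).symm

lemma incidenceSign_eq {n : ℕ} (w : Fin n ↪ V) (w' : Fin (n + 1) ↪ V)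
    (h : Finset.univ.map w ⊆ Finset.univ.map w') :
    incidenceSign w w' = 1 ∨ incidenceSign w w' = -1 := by
  have hk : ∀ k, ∃ a, w' a = w k := fun k => by
    have := h (Finset.mem_map.2 ⟨k, Finset.mem_univ _, rfl⟩)
    simpa using this
  choose f hf using hk
  obtain ⟨j, hj⟩ : ∃ j, ∀ k, f k ≠ j := by
    by_contra! hc
    have := Fintype.card_le_of_surjective f hc
    simp at this
  have hiff : ∀ l, Finset.univ.map (dropVertex w' l) = Finset.univ.map w ↔ l = j := by
    intro l
    constructor
    · intro hl
      by_contra hne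
      obtain ⟨a, ha⟩ := Fin.exists_succAbove_eq (Ne.symm hne)
      have : w' j ∈ Finset.univ.map w := by
        rw [← hl]
        exact Finset.mem_map.2 ⟨a, Finset.mem_univ _, congrArg w' ha⟩
      obtain ⟨k, -, hk⟩ := Finset.mem_map.1 this
      exact hj k (w'.injective ((hf k).trans hk))
    · rintro rfl
      refine (Finset.eq_of_subset_of_card_le ?_ (by simp)).symm
      intro v hv
      obtain ⟨k, -, rfl⟩ := Finset.mem_map.1 hv
      obtain ⟨a, ha⟩ := Fin.exists_succAbove_eq (hj k)
      exact Finset.mem_map.2 ⟨a, Finset.mem_univ _, by rw [← hf k, ← ha]; rfl⟩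
  obtain ⟨π, hπ⟩ := exists_eq_permute ((hiff j).2 rfl)
  have hs : incidenceSign w w' = (-1 : ℤ) ^ (j : ℕ) * ((Equiv.Perm.sign π : ℤˣ) : ℤ) := by
    unfold incidenceSign
    rw [Finset.sum_eq_single j]
    · rw [hπ, orderingSign_permute]
    · intro l _ hl
      rw [orderingSign_eq_zero fun h => hl ((hiff l).1 h), mul_zero]
    · simp
  rw [hs]
  rcases neg_one_pow_eq_or ℤ (j : ℕ) with h1 | h1 <;>
    rcases Int.units_eq_one_or (Equiv.Perm.sign π) with h2 | h2 <;> simp [h1, h2]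

end PreAbstractSimplicialComplex

/-- A signed graph; only the values of the signing on the edges matter. -/
structure SignedGraph (X : Type*) where
  /-- the underlying graph -/
  graph : SimpleGraph X
  /-- the signing -/
  sign : Sym2 X → ℤ
  sign_edge : ∀ e ∈ graph.edgeSet, sign e = 1 ∨ sign e = -1

/-- A signed graph is balanced if the product of the signs of the edges is `1` for each cycle. -/
def SignedGraph.IsBalanced {X : Type*} (Γ : SignedGraph X) : Prop :=
  ∀ (x : X) (c : Γ.graph.Walk x x), c.IsCycle → (c.edges.map Γ.sign).prod = 1

namespace PreAbstractSimplicialComplex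

/-- The `i`-th incidence signed graph `B_i(K)` with respect to an orientation of `K`: its
vertices are the `i`-faces and the `(i+1)`-faces, an `i`-face `F` is joined to an `(i+1)`-face
`G` if `F ⊆ G`, and this edge has the sign `sgn([F], ∂[G])`. -/
noncomputable def incidenceSignedGraph {V : Type*} (K : PreAbstractSimplicialComplex V) (i : ℕ)
    (o : K.FaceOrientation) :
    SignedGraph (K.facesOfCard (i + 1) ⊕ K.facesOfCard (i + 2)) where
  graph := SimpleGraph.fromRel fun x y => ∃ F G, x = Sum.inl F ∧ y = Sum.inr G ∧ F.1 ⊆ G.1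
  sign := Sym2.lift ⟨fun x y => match x, y with
    | Sum.inl F, Sum.inr G => incidenceSign (o.order _ F) (o.order _ G)
    | Sum.inr G, Sum.inl F => incidenceSign (o.order _ F) (o.order _ G)
    | _, _ => 0, by rintro (x | x) (y | y) <;> rfl⟩
  sign_edge := by
    intro e
    induction e with
    | _ x y =>
    rw [SimpleGraph.mem_edgeSet, SimpleGraph.fromRel_adj]
    rintro ⟨-, ⟨F, G, rfl, rfl, h⟩ | ⟨F, G, rfl, rfl, h⟩⟩ <;>
    · rw [Sym2.lift_mk]
      apply incidenceSign_eq
      rw [o.map_order, o.map_order]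
      exact h

/-! ### Wedge sums -/

open Classical in
/-- The wedge sum of `K` and `L` along `φ : F₁ ≃ F₂`: in the disjoint union of `K` and `L`, each
vertex `v` of the face `F₁` of `K` is identified with the vertex `φ v` of the face `F₂` of `L`. -/
noncomputable def wedgeSum {V W : Type*} (K : PreAbstractSimplicialComplex V)
    (L : PreAbstractSimplicialComplex W) (F₁ : Finset V) (F₂ : Finset W) (φ : F₁ ≃ F₂) :
    PreAbstractSimplicialComplex
      (Quot fun x y : V ⊕ W => ∃ v : F₁, x = Sum.inl v.1 ∧ y = Sum.inr (φ v).1) :=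
  (K.map Sum.inl ⊔ L.map Sum.inr).map (Quot.mk _)

/-- `IsIteratedWedge i p K`: the complex `K = K_p` is obtained from an `(i+1)`-simplex `K_0` by
`p` successive `i`-wedge sums with an `(i+1)`-simplex, along any `i`-faces and any
identifications of their vertices.  (`⊤` on `Fin (i + 2)` is the full simplex.) -/
inductive IsIteratedWedge (i : ℕ) :
    ℕ → ∀ {V : Type}, PreAbstractSimplicialComplex V → Prop
  | simplex : IsIteratedWedge i 0 (⊤ : PreAbstractSimplicialComplex (Fin (i + 2)))
  | wedge {p : ℕ} {V : Type} {K : PreAbstractSimplicialComplex V} (hK : IsIteratedWedge i p K)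
      (F₁ : Finset V) (F₂ : Finset (Fin (i + 2))) (hF₁ : F₁ ∈ K.facesOfCard (i + 1))
      (hF₂ : F₂ ∈ (⊤ : PreAbstractSimplicialComplex (Fin (i + 2))).facesOfCard (i + 1))
      (φ : F₁ ≃ F₂) :
      IsIteratedWedge i (p + 1) (K.wedgeSum ⊤ F₁ F₂ φ)

end PreAbstractSimplicialComplex

/-!
A wedge with an `(i+1)`-simplex along an `i`-face adds one new vertex `x` to `K` and, for the chosen
`i`-face `F`, all subsets of `F ∪ {x}`. Up to an injective renaming of vertices, `K_p` is therefore
obtained inside one vertex type by `p` such steps (`IsStacked`), and everything is proved by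
induction on the steps.

* Acyclicity: the new simplex and its intersection `2^F` with `K` are cones, and a cone has the
  contracting homotopy `[w₀, …] ↦ [v, w₀, …]` (`boundary_coneMap_succ`). A union of two acyclic
  complexes with acyclic intersection is acyclic (`IsAcyclic.union`): the two parts of a cycle have
  a common boundary in the intersection, which can be filled there.
* Path connectedness: `F` lies in an `(i+1)`-face of `K`, to which the new `(i+1)`-face is adjacent.
  So the graph of `(i+1)`-faces is connected, and a shortest walk in it has no chords, which is
  the defining property of a path of faces.
* Balance: a step adds to the incidence graph the vertex `F ∪ {x}`, joined to `F`, and `i + 1` new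
  `i`-faces joined to `F ∪ {x}` only. The graph stays a tree, so it has no cycles and is balanced
  for every orientation.
* `K_p` has `i + 2 + p` vertices, so no two of the complexes are isomorphic.
-/

namespace PreAbstractSimplicialComplex

variable {V : Type*}

/-! ### Linear maps on oriented chains -/

lemma allFaces_mono {K L : PreAbstractSimplicialComplex V} (h : K ≤ L) :
    K.allFaces ⊆ L.allFaces :=
  Set.insert_subset_insert h

lemma mem_allFaces_of_subset {K : PreAbstractSimplicialComplex V} {s t : Finset V}
    (ht : t ∈ K.allFaces) (h : s ⊆ t) : s ∈ K.allFaces := by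
  rcases s.eq_empty_or_nonempty with rfl | hs
  · exact Or.inl rfl
  · rcases ht with rfl | ht
    · exact absurd (Finset.subset_empty.1 h) hs.ne_empty
    · exact Or.inr ((K.isRelLowerSet_faces ht).2 h hs)

section Chain

variable {K : PreAbstractSimplicialComplex V} {n : ℕ} {M : Type*} [AddCommGroup M] [Module ℝ M]

/-- The linear map on chains with prescribed values on ordered faces, when these values change
by the sign of the permutation under reordering. -/
noncomputable def chainLift (f : K.OrderedFace n → M)
    (hf : ∀ w π, f (w.permute π) = (((Equiv.Perm.sign π : ℤˣ) : ℤ) : ℝ) • f w) :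
    K.Chain n →ₗ[ℝ] M :=
  (K.orientationRelations n).liftQ (Finsupp.linearCombination ℝ f) <| by
    rw [orientationRelations, Submodule.span_le]
    rintro _ ⟨w, π, rfl⟩
    simp [hf]

@[simp]
lemma chainLift_toChain (f : K.OrderedFace n → M)
    (hf : ∀ w π, f (w.permute π) = (((Equiv.Perm.sign π : ℤˣ) : ℤ) : ℝ) • f w)
    (w : K.OrderedFace n) : chainLift f hf w.toChain = f w := by
  change Finsupp.linearCombination ℝ f (Finsupp.single w 1) = f w
  rw [Finsupp.linearCombination_single, one_smul]

lemma chain_hom_ext {f g : K.Chain n →ₗ[ℝ] M}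
    (h : ∀ w : K.OrderedFace n, f w.toChain = g w.toChain) :
    f = g := by
  refine Submodule.linearMap_qext _ (Finsupp.lhom_ext' fun w => LinearMap.ext_ring ?_)
  exact h w

@[simp]
lemma boundary_toChain (w : K.OrderedFace (n + 1)) :
    K.boundary n w.toChain = ∑ j : Fin (n + 1), (-1 : ℝ) ^ (j : ℕ) • (w.dropVertex j).toChain := by
  simp [boundary, OrderedFace.toChain, preBoundary]

lemma chain_mem_of_toChain_mem (S : Submodule ℝ (K.Chain n))
    (h : ∀ w : K.OrderedFace n, w.toChain ∈ S) (z : K.Chain n) : z ∈ S := by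
  have : S.mkQ = 0 := chain_hom_ext fun w => by simpa using h w
  rw [← Submodule.Quotient.mk_eq_zero, ← Submodule.mkQ_apply, this, LinearMap.zero_apply]

end Chain

/-! ### Inclusions and restrictions of chains -/

/-- An ordered face of a subcomplex, as an ordered face of the larger complex. -/
def OrderedFace.ofLE {K L : PreAbstractSimplicialComplex V} {n : ℕ} (h : K ≤ L)
    (w : K.OrderedFace n) : L.OrderedFace n :=
  ⟨w.1, allFaces_mono h w.2⟩

/-- The map on chains induced by the inclusion of a subcomplex. -/
noncomputable def chainIncl {K L : PreAbstractSimplicialComplex V} (h : K ≤ L) (n : ℕ) :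
    K.Chain n →ₗ[ℝ] L.Chain n :=
  chainLift (fun w => (w.ofLE h).toChain) fun w π => (w.ofLE h).toChain_permute π

@[simp]
lemma chainIncl_toChain {K L : PreAbstractSimplicialComplex V} (h : K ≤ L) {n : ℕ}
    (w : K.OrderedFace n) : chainIncl h n w.toChain = (w.ofLE h).toChain :=
  chainLift_toChain _ _ _

lemma boundary_chainIncl {K L : PreAbstractSimplicialComplex V} (h : K ≤ L) {n : ℕ}
    (z : K.Chain (n + 1)) :
    L.boundary n (chainIncl h (n + 1) z) = chainIncl h n (K.boundary n z) := by
  refine LinearMap.congr_fun (f := L.boundary n ∘ₗ chainIncl h (n + 1))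
    (g := chainIncl h n ∘ₗ K.boundary n) (chain_hom_ext fun w => ?_) z
  simp only [LinearMap.comp_apply, chainIncl_toChain, boundary_toChain, map_sum, map_smul]
  rfl

lemma chainIncl_chainIncl {K L M : PreAbstractSimplicialComplex V} (h : K ≤ L) (h' : L ≤ M)
    {n : ℕ} (z : K.Chain n) :
    chainIncl h' n (chainIncl h n z) = chainIncl (h.trans h') n z := by
  refine LinearMap.congr_fun (f := chainIncl h' n ∘ₗ chainIncl h n)
    (g := chainIncl (h.trans h') n) (chain_hom_ext fun w => ?_) z
  simp only [LinearMap.comp_apply, chainIncl_toChain]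
  rfl

open Classical in
/-- The map on chains that keeps the faces lying in `K` and deletes the others. It is defined for
arbitrary `L` and `K`, and is not a chain map. -/
noncomputable def chainRestrict (L K : PreAbstractSimplicialComplex V) (n : ℕ) :
    L.Chain n →ₗ[ℝ] K.Chain n :=
  chainLift (fun w => if h : Finset.univ.map w.1 ∈ K.allFaces then
      OrderedFace.toChain (K := K) ⟨w.1, h⟩ else 0) fun w π => by
    have hw : Finset.univ.map (w.permute π).1 = Finset.univ.map w.1 := map_permute w.1 π
    by_cases h : Finset.univ.map w.1 ∈ K.allFaces
    · rw [dif_pos h, dif_pos (hw ▸ h)]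
      exact OrderedFace.toChain_permute (K := K) ⟨w.1, h⟩ π
    · rw [dif_neg h, dif_neg (hw ▸ h), smul_zero]

lemma chainRestrict_toChain_of_mem {L : PreAbstractSimplicialComplex V}
    (K : PreAbstractSimplicialComplex V) {n : ℕ} (w : L.OrderedFace n)
    (h : Finset.univ.map w.1 ∈ K.allFaces) :
    chainRestrict L K n w.toChain = OrderedFace.toChain (K := K) ⟨w.1, h⟩ := by
  simp [chainRestrict, h]

lemma chainRestrict_toChain_of_notMem {L : PreAbstractSimplicialComplex V}
    (K : PreAbstractSimplicialComplex V) {n : ℕ} (w : L.OrderedFace n)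
    (h : Finset.univ.map w.1 ∉ K.allFaces) :
    chainRestrict L K n w.toChain = 0 := by
  simp [chainRestrict, h]

lemma chainRestrict_chainIncl {K L : PreAbstractSimplicialComplex V} (h : K ≤ L) {n : ℕ}
    (z : K.Chain n) : chainRestrict L K n (chainIncl h n z) = z := by
  refine LinearMap.congr_fun (f := chainRestrict L K n ∘ₗ chainIncl h n)
    (g := LinearMap.id) (chain_hom_ext fun w => ?_) z
  rw [LinearMap.comp_apply, chainIncl_toChain, chainRestrict_toChain_of_mem K (w.ofLE h) w.2]
  rfl

lemma chainIncl_injective {K L : PreAbstractSimplicialComplex V} (h : K ≤ L) (n : ℕ) :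
    Function.Injective (chainIncl h n) :=
  Function.LeftInverse.injective (chainRestrict_chainIncl h)

/-- A chain of `K` restricted to `L` is a chain of `K ⊓ L`. -/
lemma chainRestrict_chainIncl_inf {K L X : PreAbstractSimplicialComplex V} (hK : K ≤ X) {n : ℕ}
    (z : K.Chain n) :
    chainRestrict X L n (chainIncl hK n z) =
      chainIncl inf_le_right n (chainRestrict K (K ⊓ L) n z) := by
  refine LinearMap.congr_fun (f := chainRestrict X L n ∘ₗ chainIncl hK n)
    (g := chainIncl inf_le_right n ∘ₗ chainRestrict K (K ⊓ L) n) (chain_hom_ext fun w => ?_) z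
  rw [LinearMap.comp_apply, LinearMap.comp_apply, chainIncl_toChain]
  by_cases h : Finset.univ.map w.1 ∈ L.allFaces
  · have h' : Finset.univ.map w.1 ∈ (K ⊓ L).allFaces := by
      rcases h with h | h
      · exact Or.inl h
      · rcases w.2 with h2 | h2
        · exact Or.inl h2
        · exact Or.inr ⟨h2, h⟩
    rw [chainRestrict_toChain_of_mem L (w.ofLE hK) h, chainRestrict_toChain_of_mem _ w h']
    exact (chainIncl_toChain inf_le_right (⟨w.1, h'⟩ : (K ⊓ L).OrderedFace n)).symm
  · have h' : Finset.univ.map w.1 ∉ (K ⊓ L).allFaces :=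
      fun h' => h (allFaces_mono inf_le_right h')
    rw [chainRestrict_toChain_of_notMem L (w.ofLE hK) h,
      chainRestrict_toChain_of_notMem _ w h', map_zero]

/-! ### Cones -/

open Classical in
/-- `K` is a cone with apex `v`: adding `v` to a face, empty or not, gives a face. -/
def IsCone (K : PreAbstractSimplicialComplex V) (v : V) : Prop :=
  ∀ s ∈ K.allFaces, insert v s ∈ K.faces

/-- The ordered face `[v, w₀, …]` of a cone with apex `v`. -/
def OrderedFace.cons {K : PreAbstractSimplicialComplex V} {v : V} (hK : K.IsCone v) {n : ℕ}
    (w : K.OrderedFace n) (hv : v ∉ Finset.univ.map w.1) : K.OrderedFace (n + 1) :=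
  ⟨Fin.Embedding.cons w.1 (a := v) (by simpa using hv), Or.inr (by
    classical
    convert hK _ w.2
    ext x
    simp [Fin.exists_fin_succ, eq_comm])⟩

lemma cons_apply_zero {K : PreAbstractSimplicialComplex V} {v : V} (hK : K.IsCone v) {n : ℕ}
    (w : K.OrderedFace n) (hv : v ∉ Finset.univ.map w.1) : (w.cons hK hv).1 0 = v := rfl

lemma cons_apply_succ {K : PreAbstractSimplicialComplex V} {v : V} (hK : K.IsCone v) {n : ℕ}
    (w : K.OrderedFace n) (hv : v ∉ Finset.univ.map w.1) (k : Fin n) :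
    (w.cons hK hv).1 k.succ = w.1 k := rfl

lemma orderedFace_ext {K : PreAbstractSimplicialComplex V} {n : ℕ} {w w' : K.OrderedFace n}
    (h : ∀ k, w.1 k = w'.1 k) : w = w' :=
  Subtype.ext (DFunLike.ext _ _ h)

lemma OrderedFace.map_permute {K : PreAbstractSimplicialComplex V} {n : ℕ} (w : K.OrderedFace n)
    (π : Equiv.Perm (Fin n)) : Finset.univ.map (w.permute π).1 = Finset.univ.map w.1 :=
  PreAbstractSimplicialComplex.map_permute w.1 π

open Classical in
/-- The cone operator `[w₀, …] ↦ [v, w₀, …]`, where faces containing the apex `v` go to `0`. -/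
noncomputable def coneMap {K : PreAbstractSimplicialComplex V} {v : V} (hK : K.IsCone v) (n : ℕ) :
    K.Chain n →ₗ[ℝ] K.Chain (n + 1) :=
  chainLift (fun w => if hv : v ∉ Finset.univ.map w.1 then (w.cons hK hv).toChain else 0)
    fun w π => by
      have hw := w.map_permute π
      by_cases hv : v ∉ Finset.univ.map w.1
      · have hv' : v ∉ Finset.univ.map (w.permute π).1 := hw ▸ hv
        have h : (w.permute π).cons hK hv' =
            (w.cons hK hv).permute (Equiv.Perm.decomposeFin.symm (0, π)) := by
          refine orderedFace_ext fun k => ?_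
          refine Fin.cases ?_ (fun k => ?_) k
          · change v = (w.cons hK hv).1 (Equiv.Perm.decomposeFin.symm (0, π) 0)
            rw [Equiv.Perm.decomposeFin_symm_apply_zero, cons_apply_zero]
          · change w.1 (π k) = (w.cons hK hv).1 (Equiv.Perm.decomposeFin.symm (0, π) k.succ)
            rw [Equiv.Perm.decomposeFin_symm_apply_succ, Equiv.swap_self, Equiv.refl_apply,
              cons_apply_succ]
        rw [dif_pos hv, dif_pos hv', h, OrderedFace.toChain_permute,
          Equiv.Perm.decomposeFin.symm_sign, if_pos rfl, one_mul]
      · rw [dif_neg hv, dif_neg (hw ▸ hv), smul_zero]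

lemma coneMap_toChain_of_notMem {K : PreAbstractSimplicialComplex V} {v : V} (hK : K.IsCone v)
    {n : ℕ} (w : K.OrderedFace n) (hv : v ∉ Finset.univ.map w.1) :
    coneMap hK n w.toChain = (w.cons hK hv).toChain := by
  rw [coneMap, chainLift_toChain, dif_pos hv]

lemma coneMap_toChain_of_mem {K : PreAbstractSimplicialComplex V} {v : V} (hK : K.IsCone v)
    {n : ℕ} (w : K.OrderedFace n) (hv : v ∈ Finset.univ.map w.1) :
    coneMap hK n w.toChain = 0 := by
  rw [coneMap, chainLift_toChain, dif_neg (not_not.2 hv)]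

lemma cons_dropVertex_zero {K : PreAbstractSimplicialComplex V} {v : V} (hK : K.IsCone v) {n : ℕ}
    (w : K.OrderedFace n) (hv : v ∉ Finset.univ.map w.1) : (w.cons hK hv).dropVertex 0 = w :=
  orderedFace_ext fun _ => rfl

lemma notMem_dropVertex {K : PreAbstractSimplicialComplex V} {v : V} {n : ℕ}
    {w : K.OrderedFace (n + 1)} (hv : v ∉ Finset.univ.map w.1) (j : Fin (n + 1)) :
    v ∉ Finset.univ.map (w.dropVertex j).1 := by
  intro h
  obtain ⟨k, -, hk⟩ := Finset.mem_map.1 h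
  exact hv (Finset.mem_map.2 ⟨j.succAbove k, Finset.mem_univ _, hk⟩)

lemma cons_dropVertex_succ {K : PreAbstractSimplicialComplex V} {v : V} (hK : K.IsCone v) {n : ℕ}
    (w : K.OrderedFace (n + 1)) (hv : v ∉ Finset.univ.map w.1) (j : Fin (n + 1)) :
    (w.cons hK hv).dropVertex j.succ = (w.dropVertex j).cons hK (notMem_dropVertex hv j) := by
  refine orderedFace_ext fun k => ?_
  change (w.cons hK hv).1 (j.succ.succAbove k) = _
  refine Fin.cases ?_ (fun k => ?_) k
  · rw [Fin.succ_succAbove_zero, cons_apply_zero, cons_apply_zero]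
  · rw [Fin.succ_succAbove_succ, cons_apply_succ, cons_apply_succ]
    rfl

lemma boundary_coneMap_zero {K : PreAbstractSimplicialComplex V} {v : V} (hK : K.IsCone v)
    (z : K.Chain 0) : K.boundary 0 (coneMap hK 0 z) = z := by
  refine LinearMap.congr_fun (f := K.boundary 0 ∘ₗ coneMap hK 0)
    (g := LinearMap.id) (chain_hom_ext fun w => ?_) z
  rw [LinearMap.comp_apply, coneMap_toChain_of_notMem hK w (by simp), boundary_toChain,
    Fin.sum_univ_one, cons_dropVertex_zero]
  simp

/-- The cone operator is a contracting homotopy: `∂ D + D ∂ = 1`. -/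
lemma boundary_coneMap_succ {K : PreAbstractSimplicialComplex V} {v : V} (hK : K.IsCone v) {n : ℕ}
    (z : K.Chain (n + 1)) :
    K.boundary (n + 1) (coneMap hK (n + 1) z) + coneMap hK n (K.boundary n z) = z := by
  refine LinearMap.congr_fun
    (f := K.boundary (n + 1) ∘ₗ coneMap hK (n + 1) + coneMap hK n ∘ₗ K.boundary n)
    (g := LinearMap.id) (chain_hom_ext fun w => ?_) z
  simp only [LinearMap.add_apply, LinearMap.comp_apply, LinearMap.id_apply, boundary_toChain,
    map_sum, map_smul]
  by_cases hv : v ∈ Finset.univ.map w.1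
  · obtain ⟨j, -, hj⟩ := Finset.mem_map.1 hv
    have hj' : v ∉ Finset.univ.map (w.dropVertex j).1 := by
      intro h
      obtain ⟨k, -, hk⟩ := Finset.mem_map.1 h
      exact Fin.succAbove_ne j k (w.1.injective (hk.trans hj.symm))
    -- Only the term omitting `v` survives; moving `v` back to its place is a cycle of sign `(-1)ʲ`.
    have hw : ((w.dropVertex j).cons hK hj').permute j.cycleRange = w := by
      refine orderedFace_ext fun k => ?_
      obtain ⟨k, rfl⟩ := j.cycleRange.symm.surjective k
      change ((w.dropVertex j).cons hK hj').1 (j.cycleRange (j.cycleRange.symm k)) = _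
      rw [Equiv.apply_symm_apply]
      refine Fin.cases ?_ (fun k => ?_) k
      · rw [cons_apply_zero, Fin.cycleRange_symm_zero, hj]
      · rw [cons_apply_succ, Fin.cycleRange_symm_succ]
        rfl
    rw [coneMap_toChain_of_mem hK w hv, map_zero, zero_add, Finset.sum_eq_single j]
    · rw [coneMap_toChain_of_notMem hK _ hj']
      conv_rhs => rw [← hw, OrderedFace.toChain_permute, Fin.sign_cycleRange]
      simp
    · intro l _ hl
      rw [coneMap_toChain_of_mem, smul_zero]
      obtain ⟨a, ha⟩ := Fin.exists_succAbove_eq (Ne.symm hl)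
      exact Finset.mem_map.2 ⟨a, Finset.mem_univ _, (congrArg w.1 ha).trans hj⟩
    · simp
  · rw [coneMap_toChain_of_notMem hK w hv, boundary_toChain, Fin.sum_univ_succ,
      cons_dropVertex_zero, add_assoc, ← Finset.sum_add_distrib, Finset.sum_eq_zero]
    · simp
    · intro j _
      rw [cons_dropVertex_succ, coneMap_toChain_of_notMem hK _ (notMem_dropVertex hv j)]
      simp [pow_succ]

lemma isAcyclic_iff {K : PreAbstractSimplicialComplex V} :
    K.IsAcyclic ↔ ∀ n, K.cycles n ≤ LinearMap.range (K.boundary n) := by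
  refine forall_congr' fun n => ?_
  rw [Submodule.Quotient.subsingleton_iff, Submodule.submoduleOf_eq_top]

lemma IsCone.isAcyclic {K : PreAbstractSimplicialComplex V} {v : V} (hK : K.IsCone v) :
    K.IsAcyclic := by
  refine isAcyclic_iff.2 fun n z hz => ?_
  cases n with
  | zero => exact ⟨_, boundary_coneMap_zero hK z⟩
  | succ n =>
    have h := boundary_coneMap_succ hK z
    rw [LinearMap.mem_ker.1 hz, map_zero, add_zero] at h
    exact ⟨_, h⟩

/-! ### Simplices -/

/-- The simplex on the vertex set `T`, with all its faces. -/
def fullSimplex (T : Finset V) : PreAbstractSimplicialComplex V where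
  faces := {s | s.Nonempty ∧ s ⊆ T}
  isRelLowerSet_faces := fun {_} h => ⟨h.1, fun _ hts ht => ⟨ht, hts.trans h.2⟩⟩

lemma mem_allFaces_fullSimplex {T s : Finset V} : s ∈ (fullSimplex T).allFaces ↔ s ⊆ T := by
  constructor
  · rintro (rfl | h)
    · exact Finset.empty_subset _
    · exact h.2
  · intro h
    rcases s.eq_empty_or_nonempty with rfl | hs
    · exact Or.inl rfl
    · exact Or.inr ⟨hs, h⟩

lemma isCone_fullSimplex {T : Finset V} {v : V} (hv : v ∈ T) : (fullSimplex T).IsCone v := by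
  classical
  exact fun s hs => ⟨by simp, Finset.insert_subset hv (mem_allFaces_fullSimplex.1 hs)⟩

lemma fullSimplex_le {K : PreAbstractSimplicialComplex V} {T : Finset V} (hT : T ∈ K.allFaces) :
    fullSimplex T ≤ K := fun s hs => by
  rcases mem_allFaces_of_subset hT hs.2 with h | h
  · exact absurd h hs.1.ne_empty
  · exact h

/-- An oriented face is the cone over its tail inside the simplex it spans. -/
lemma OrderedFace.exists_toChain_eq_coneMap {K : PreAbstractSimplicialComplex V} {n : ℕ}
    (w : K.OrderedFace (n + 1)) :
    ∃ (T : Finset V) (hT : fullSimplex T ≤ K) (v : V) (hD : (fullSimplex T).IsCone v)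
      (u : (fullSimplex T).Chain n), w.toChain = chainIncl hT (n + 1) (coneMap hD n u) := by
  have hD := isCone_fullSimplex (T := Finset.univ.map w.1) (v := w.1 0) (by simp)
  let u : (fullSimplex (Finset.univ.map w.1)).OrderedFace n :=
    ⟨PreAbstractSimplicialComplex.dropVertex w.1 0, mem_allFaces_fullSimplex.2 fun x hx => by
      obtain ⟨k, -, hk⟩ := Finset.mem_map.1 hx
      exact Finset.mem_map.2 ⟨_, Finset.mem_univ _, hk⟩⟩
  have hu : w.1 0 ∉ Finset.univ.map u.1 := fun hx => by
    obtain ⟨k, -, hk⟩ := Finset.mem_map.1 hx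
    exact Fin.succAbove_ne 0 k (w.1.injective hk)
  refine ⟨_, fullSimplex_le w.2, _, hD, u.toChain, ?_⟩
  rw [coneMap_toChain_of_notMem hD u hu, chainIncl_toChain]
  exact congrArg _ (orderedFace_ext fun k => Fin.cases rfl (fun _ => rfl) k)

/-- `∂ ∂ = 0`: an oriented face is a cone `D u`, and `∂ ∂ D u = D ∂ ∂ u` by the homotopy formula,
so that induction on the dimension applies. -/
lemma boundary_boundary (n : ℕ) : ∀ (K : PreAbstractSimplicialComplex V) (z : K.Chain (n + 2)),
    K.boundary n (K.boundary (n + 1) z) = 0 := by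
  induction n with
  | zero =>
    intro K z
    refine LinearMap.congr_fun (f := K.boundary 0 ∘ₗ K.boundary 1) (g := 0)
      (chain_hom_ext fun w => ?_) z
    obtain ⟨T, hT, v, hD, u, hw⟩ := w.exists_toChain_eq_coneMap
    rw [LinearMap.comp_apply, hw, boundary_chainIncl, boundary_chainIncl,
      eq_sub_of_add_eq (boundary_coneMap_succ hD u), map_sub, boundary_coneMap_zero,
      sub_self, map_zero, LinearMap.zero_apply]
  | succ n ih =>
    intro K z
    refine LinearMap.congr_fun (f := K.boundary (n + 1) ∘ₗ K.boundary (n + 2)) (g := 0)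
      (chain_hom_ext fun w => ?_) z
    obtain ⟨T, hT, v, hD, u, hw⟩ := w.exists_toChain_eq_coneMap
    rw [LinearMap.comp_apply, hw, boundary_chainIncl, boundary_chainIncl,
      eq_sub_of_add_eq (boundary_coneMap_succ hD u), map_sub,
      eq_sub_of_add_eq (boundary_coneMap_succ hD (boundary _ (n + 1) u)), ih, map_zero,
      sub_zero, sub_self, map_zero, LinearMap.zero_apply]

/-! ### Unions of acyclic complexes -/

/-- The vanishing part of the Mayer–Vietoris sequence. -/
lemma IsAcyclic.union {K L X : PreAbstractSimplicialComplex V} (hK : K ≤ X) (hL : L ≤ X)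
    (hX : ∀ s ∈ X.faces, s ∈ K.faces ∨ s ∈ L.faces) (aK : K.IsAcyclic) (aL : L.IsAcyclic)
    (aM : (K ⊓ L).IsAcyclic) : X.IsAcyclic := by
  rw [isAcyclic_iff] at *
  intro n z hz
  have hspan : z ∈ LinearMap.range (chainIncl hK n) ⊔ LinearMap.range (chainIncl hL n) := by
    refine chain_mem_of_toChain_mem _ (fun w => ?_) z
    have hw : Finset.univ.map w.1 ∈ K.allFaces ∨ Finset.univ.map w.1 ∈ L.allFaces := by
      rcases w.2 with h | h
      · exact Or.inl (Or.inl h)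
      · exact (hX _ h).imp Or.inr Or.inr
    rcases hw with h | h
    · exact Submodule.mem_sup_left ⟨OrderedFace.toChain (K := K) ⟨w.1, h⟩, chainIncl_toChain _ _⟩
    · exact Submodule.mem_sup_right ⟨OrderedFace.toChain (K := L) ⟨w.1, h⟩, chainIncl_toChain _ _⟩
  obtain ⟨_, ⟨a, rfl⟩, _, ⟨b, rfl⟩, rfl⟩ := Submodule.mem_sup.1 hspan
  cases n with
  | zero =>
    obtain ⟨a', rfl⟩ := aK 0 (show a ∈ K.cycles 0 from Submodule.mem_top)
    obtain ⟨b', rfl⟩ := aL 0 (show b ∈ L.cycles 0 from Submodule.mem_top)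
    exact ⟨chainIncl hK 1 a' + chainIncl hL 1 b', by
      rw [map_add, boundary_chainIncl, boundary_chainIncl]⟩
  | succ n =>
    have hz0 : chainIncl hL n (L.boundary n b) = chainIncl hK n (-K.boundary n a) := by
      have := LinearMap.mem_ker.1 hz
      rw [map_add, boundary_chainIncl, boundary_chainIncl] at this
      rw [map_neg]
      exact (neg_eq_of_add_eq_zero_right this).symm
    -- The common boundary `∂b = -∂a` is a cycle `m` of `K ⊓ L`.
    set m := chainRestrict K (K ⊓ L) n (-K.boundary n a) with hm
    have hmL : chainIncl inf_le_right n m = L.boundary n b := by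
      rw [hm, ← chainRestrict_chainIncl_inf hK, ← hz0, chainRestrict_chainIncl]
    have hmK : chainIncl inf_le_left n m = -K.boundary n a := by
      apply chainIncl_injective hK n
      rw [← hz0, ← hmL, chainIncl_chainIncl, chainIncl_chainIncl]
    have hmc : m ∈ (K ⊓ L).cycles n := by
      cases n with
      | zero => exact Submodule.mem_top
      | succ n =>
        refine LinearMap.mem_ker.2 (chainIncl_injective inf_le_right n ?_)
        rw [← boundary_chainIncl, hmL, boundary_boundary, map_zero]
    obtain ⟨c, hc⟩ := aM n hmc
    obtain ⟨a', ha'⟩ := aK (n + 1)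
      (show a + chainIncl inf_le_left (n + 1) c ∈ K.cycles (n + 1) from LinearMap.mem_ker.2 (by
        rw [map_add, boundary_chainIncl, hc, hmK, add_neg_cancel]))
    obtain ⟨b', hb'⟩ := aL (n + 1)
      (show b - chainIncl inf_le_right (n + 1) c ∈ L.cycles (n + 1) from LinearMap.mem_ker.2 (by
        rw [map_sub, boundary_chainIncl, hc, hmL, sub_self]))
    refine ⟨chainIncl hK (n + 2) a' + chainIncl hL (n + 2) b', ?_⟩
    rw [map_add, boundary_chainIncl, boundary_chainIncl, ha', hb', map_add, map_sub,
      chainIncl_chainIncl, chainIncl_chainIncl]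
    abel

/-! ### Stacked complexes -/

open Classical in
/-- Complexes built inside a fixed vertex type from an `(i+1)`-simplex by repeatedly choosing an
`i`-face `F` and a new vertex `x` and adding the simplex on `F ∪ {x}`. -/
inductive IsStacked (i : ℕ) : PreAbstractSimplicialComplex V → Prop
  | simplex (T : Finset V) (hT : T.card = i + 2) : IsStacked i (fullSimplex T)
  | attach {K : PreAbstractSimplicialComplex V} (hK : IsStacked i K) (x : V) (F : Finset V)
      (hF : F ∈ K.facesOfCard (i + 1)) (hx : ∀ s ∈ K.faces, x ∉ s) :
      IsStacked i (K ⊔ fullSimplex (insert x F))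

lemma mem_allFaces_sup {K L : PreAbstractSimplicialComplex V} {s : Finset V} :
    s ∈ (K ⊔ L).allFaces ↔ s ∈ K.allFaces ∨ s ∈ L.allFaces :=
  or_or_distrib_left

lemma mem_facesOfCard_sup {K L : PreAbstractSimplicialComplex V} {n : ℕ} {s : Finset V} :
    s ∈ (K ⊔ L).facesOfCard n ↔ s ∈ K.facesOfCard n ∨ s ∈ L.facesOfCard n := by
  simp only [facesOfCard, Set.mem_ofPred_eq, mem_allFaces_sup, or_and_right]

lemma mem_facesOfCard_fullSimplex {T s : Finset V} {n : ℕ} :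
    s ∈ (fullSimplex T).facesOfCard n ↔ s ⊆ T ∧ s.card = n := by
  simp only [facesOfCard, Set.mem_ofPred_eq, mem_allFaces_fullSimplex]

lemma mem_faces_of_mem_facesOfCard_succ {K : PreAbstractSimplicialComplex V} {n : ℕ}
    {s : Finset V} (hs : s ∈ K.facesOfCard (n + 1)) : s ∈ K.faces := by
  rcases hs with ⟨rfl | h, hc⟩
  · simp at hc
  · exact h

open Classical in
/-- Attaching a simplex along a nonempty face preserves acyclicity: the simplex and the face are
cones. -/
lemma IsAcyclic.attach {K : PreAbstractSimplicialComplex V} (hK : K.IsAcyclic) {x : V}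
    {F : Finset V} (hF : F ∈ K.faces) (hx : ∀ s ∈ K.faces, x ∉ s) :
    (K ⊔ fullSimplex (insert x F)).IsAcyclic := by
  obtain ⟨v, hv⟩ := (K.isRelLowerSet_faces hF).1
  refine IsAcyclic.union le_sup_left le_sup_right (fun s hs => hs) hK
    (isCone_fullSimplex (Finset.mem_insert_self x F)).isAcyclic (IsCone.isAcyclic (v := v) ?_)
  intro s hs
  have hsF : s ⊆ F := by
    rcases hs with rfl | ⟨hs1, hs2⟩
    · exact Finset.empty_subset _
    · exact (Finset.subset_insert_iff_of_notMem (hx s hs1)).1 hs2.2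
  have h : insert v s ⊆ F := Finset.insert_subset hv hsF
  exact ⟨(K.isRelLowerSet_faces hF).2 h (Finset.insert_nonempty v s),
    Finset.insert_nonempty v s, h.trans (Finset.subset_insert x F)⟩

lemma IsStacked.isAcyclic {i : ℕ} {K : PreAbstractSimplicialComplex V} (h : IsStacked i K) :
    K.IsAcyclic := by
  induction h with
  | simplex T hT =>
    obtain ⟨v, hv⟩ := Finset.card_pos.1 (by omega : 0 < T.card)
    exact (isCone_fullSimplex hv).isAcyclic
  | attach hK x F hF hx ih => exact ih.attach (mem_faces_of_mem_facesOfCard_succ hF) hx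

/-! ### Path connectedness -/

open Classical in
/-- The graph of `d`-faces of `K`, two of them being adjacent when they share a
`(d - 1)`-face. -/
def dualGraph (K : PreAbstractSimplicialComplex V) (d : ℕ) : SimpleGraph (Finset V) where
  Adj s t := s ∈ K.facesOfCard (d + 1) ∧ t ∈ K.facesOfCard (d + 1) ∧ (s ∩ t).card = d
  symm := ⟨fun s t h => ⟨h.2.1, h.1, by rw [Finset.inter_comm]; exact h.2.2⟩⟩
  loopless := ⟨fun s h => by
    have h1 := h.1.2
    have h2 := h.2.2
    rw [Finset.inter_self] at h2
    omega⟩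

end PreAbstractSimplicialComplex

/-- A shortest walk has no chords. -/
lemma SimpleGraph.Walk.adj_getVert_iff_of_length_eq_dist {X : Type*} {G : SimpleGraph X} {u v : X}
    (p : G.Walk u v) (hp : p.length = G.dist u v) {a b : ℕ} (ha : a ≤ p.length)
    (hb : b ≤ p.length) :
    G.Adj (p.getVert a) (p.getVert b) ↔ a + 1 = b ∨ b + 1 = a := by
  have key : ∀ a b, a ≤ p.length → b ≤ p.length → G.Adj (p.getVert a) (p.getVert b) →
      b ≤ a + 1 := by
    intro a b ha hb h
    have h1 := G.dist_le (((p.take a).append (Walk.cons h (p.drop b))))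
    rw [← hp] at h1
    simp only [Walk.length_append, Walk.length_cons, Walk.take_length, Walk.drop_length] at h1
    omega
  constructor
  · intro h
    have h1 := key a b ha hb h
    have h2 := key b a hb ha h.symm
    have h3 : a ≠ b := fun h' => h.ne (by rw [h'])
    omega
  · rintro (rfl | rfl)
    · exact p.adj_getVert_succ hb
    · exact (p.adj_getVert_succ ha).symm

namespace PreAbstractSimplicialComplex

variable {V : Type*}

/-- If the dual graph is connected, then shortest walks in it are paths of faces. -/
lemma facePathConnected_of_reachable {K : PreAbstractSimplicialComplex V} {d : ℕ}
    (h : ∀ F ∈ K.facesOfCard (d + 1), ∀ G ∈ K.facesOfCard (d + 1), (K.dualGraph d).Reachable F G) :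
    K.FacePathConnected d := by
  classical
  intro F hF G hG
  obtain ⟨p, hp⟩ := (h F hF G hG).exists_walk_length_eq_dist
  have hmem : ∀ a, p.getVert a ∈ K.facesOfCard (d + 1) := by
    intro a
    rcases lt_or_ge a p.length with ha | ha
    · exact (p.adj_getVert_succ ha).1
    · rw [p.getVert_of_length_le ha]
      exact hG
  refine ⟨p.length, fun a => p.getVert a, ⟨fun a => hmem a, fun a b hab => ?_, fun a b => ?_⟩,
    p.getVert_zero, p.getVert_length⟩
  · exact Fin.ext ((p.isPath_of_length_eq_dist hp).getVert_injOn (Nat.le_of_lt_succ a.2)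
      (Nat.le_of_lt_succ b.2) hab)
  · rw [← p.adj_getVert_iff_of_length_eq_dist hp (Nat.le_of_lt_succ a.2) (Nat.le_of_lt_succ b.2)]
    constructor
    · intro hab
      exact ⟨hmem a, hmem b, hab.2⟩
    · intro hab
      refine ⟨mem_allFaces_of_subset (hmem a).1 ?_, hab.2.2⟩
      exact Finset.inter_subset_left

lemma dualGraph_mono {K L : PreAbstractSimplicialComplex V} (h : K ≤ L) (d : ℕ) :
    K.dualGraph d ≤ L.dualGraph d :=
  fun _ _ hst => ⟨⟨allFaces_mono h hst.1.1, hst.1.2⟩, ⟨allFaces_mono h hst.2.1.1, hst.2.1.2⟩,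
    hst.2.2⟩

/-- In a stacked complex every `i`-face lies in an `(i+1)`-face. -/
lemma IsStacked.exists_superset {i : ℕ} {K : PreAbstractSimplicialComplex V} (h : IsStacked i K) :
    ∀ F ∈ K.facesOfCard (i + 1), ∃ G ∈ K.facesOfCard (i + 2), F ⊆ G := by
  classical
  induction h with
  | simplex T hT =>
    intro F hF
    exact ⟨T, mem_facesOfCard_fullSimplex.2 ⟨subset_rfl, hT⟩, (mem_facesOfCard_fullSimplex.1 hF).1⟩
  | @attach K hK x F hF hx ih =>
    intro s hs
    rcases mem_facesOfCard_sup.1 hs with hs | hs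
    · obtain ⟨G, hG, h⟩ := ih s hs
      exact ⟨G, mem_facesOfCard_sup.2 (Or.inl hG), h⟩
    · have hxF := hx F (mem_faces_of_mem_facesOfCard_succ hF)
      refine ⟨insert x F, mem_facesOfCard_sup.2 (Or.inr (mem_facesOfCard_fullSimplex.2 ?_)), ?_⟩
      · refine ⟨subset_rfl, ?_⟩
        rw [Finset.card_insert_of_notMem hxF, hF.2]
      · exact (mem_facesOfCard_fullSimplex.1 hs).1

lemma IsStacked.reachable {i : ℕ} {K : PreAbstractSimplicialComplex V} (h : IsStacked i K) :
    ∀ s ∈ K.facesOfCard (i + 2), ∀ t ∈ K.facesOfCard (i + 2),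
      (K.dualGraph (i + 1)).Reachable s t := by
  classical
  induction h with
  | simplex T hT =>
    intro s hs t ht
    obtain ⟨hs1, hs2⟩ := mem_facesOfCard_fullSimplex.1 hs
    obtain ⟨ht1, ht2⟩ := mem_facesOfCard_fullSimplex.1 ht
    rw [Finset.eq_of_subset_of_card_le hs1 (by omega),
      Finset.eq_of_subset_of_card_le ht1 (by omega)]
  | @attach K hK x F hF hx ih =>
    have hxF := hx F (mem_faces_of_mem_facesOfCard_succ hF)
    have hc : (insert x F).card = i + 2 := by rw [Finset.card_insert_of_notMem hxF, hF.2]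
    obtain ⟨G, hG, hFG⟩ := hK.exists_superset F hF
    have hxG := hx G (mem_faces_of_mem_facesOfCard_succ hG)
    -- Every `(i+1)`-face is joined to `G`: the new one is adjacent to it through `F`.
    have key : ∀ s ∈ (K ⊔ fullSimplex (insert x F)).facesOfCard (i + 2),
        ((K ⊔ fullSimplex (insert x F)).dualGraph (i + 1)).Reachable s G := by
      intro s hs
      rcases mem_facesOfCard_sup.1 hs with h | h
      · exact (ih s h G hG).mono (dualGraph_mono le_sup_left _)
      · obtain ⟨h1, h2⟩ := mem_facesOfCard_fullSimplex.1 h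
        obtain rfl := Finset.eq_of_subset_of_card_le h1 (by omega)
        refine SimpleGraph.Adj.reachable ⟨hs, mem_facesOfCard_sup.2 (Or.inl hG), ?_⟩
        have : insert x F ∩ G = F := by
          rw [Finset.insert_inter_of_notMem hxG, Finset.inter_eq_left.2 hFG]
        convert hF.2
    intro s hs t ht
    exact (key s hs).trans (key t ht).symm

/-! ### The incidence graph is a forest -/

/-- The incidence graph of the `i`-faces and the `(i+1)`-faces, on all finite sets of vertices. -/
def incidenceGraph (K : PreAbstractSimplicialComplex V) (i : ℕ) : SimpleGraph (Finset V) where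
  Adj s t := (s ∈ K.facesOfCard (i + 1) ∧ t ∈ K.facesOfCard (i + 2) ∧ s ⊆ t) ∨
    (t ∈ K.facesOfCard (i + 1) ∧ s ∈ K.facesOfCard (i + 2) ∧ t ⊆ s)
  symm := ⟨fun _ _ h => h.symm⟩
  loopless := ⟨fun s h => by
    rcases h with ⟨⟨_, h1⟩, ⟨_, h2⟩, _⟩ | ⟨⟨_, h1⟩, ⟨_, h2⟩, _⟩ <;> omega⟩

end PreAbstractSimplicialComplex

/-- A graph is a forest if each nonempty finite set of vertices contains a vertex with at most one
neighbour in the set; this is applied to the vertices of a cycle. -/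
lemma SimpleGraph.isAcyclic_of_exists_subsingleton {X : Type*} {G : SimpleGraph X}
    (h : ∀ S : Finset X, S.Nonempty →
      ∃ v ∈ S, ∀ a ∈ S, ∀ b ∈ S, G.Adj v a → G.Adj v b → a = b) : G.IsAcyclic := by
  classical
  intro u c hc
  obtain ⟨v, hv, hS⟩ := h c.support.toFinset ⟨u, by simp⟩
  have hv' : v ∈ c.support := by simpa using hv
  have hr := hc.rotate hv'
  have hmem : ∀ a, a ∈ (c.rotate v hv').support → a ∈ c.support.toFinset := fun a ha => by
    rw [List.mem_toFinset]
    exact (c.mem_support_rotate_iff v hv').1 ha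
  exact hr.snd_ne_penultimate (hS _ (hmem _ (Walk.getVert_mem_support _ _)) _
    (hmem _ (Walk.getVert_mem_support _ _)) (Walk.adj_snd hr.not_nil)
    (Walk.adj_penultimate hr.not_nil).symm)

namespace PreAbstractSimplicialComplex

variable {V : Type*}

/-- Attaching a simplex adds to the incidence graph one vertex joined to the face `F`, and pendant
vertices joined to that new vertex. -/
lemma IsStacked.exists_subsingleton_adj {i : ℕ} {K : PreAbstractSimplicialComplex V}
    (h : IsStacked i K) : ∀ S : Finset (Finset V), S.Nonempty →
      ∃ v ∈ S, ∀ a ∈ S, ∀ b ∈ S,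
        (K.incidenceGraph i).Adj v a → (K.incidenceGraph i).Adj v b → a = b := by
  classical
  induction h with
  | simplex T hT =>
    have key : ∀ s t, ((fullSimplex T).incidenceGraph i).Adj s t → s ≠ T → t = T := by
      rintro s t (⟨h1, h2, h3⟩ | ⟨h1, h2, h3⟩) hs
      · obtain ⟨h4, h5⟩ := mem_facesOfCard_fullSimplex.1 h2
        exact Finset.eq_of_subset_of_card_le h4 (by omega)
      · obtain ⟨h4, h5⟩ := mem_facesOfCard_fullSimplex.1 h2
        exact absurd (Finset.eq_of_subset_of_card_le h4 (by omega)) hs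
    intro S hS
    by_cases hT' : ∃ s ∈ S, s ≠ T
    · obtain ⟨s, hs, hsT⟩ := hT'
      exact ⟨s, hs, fun a _ b _ ha hb => (key s a ha hsT).trans (key s b hb hsT).symm⟩
    · push Not at hT'
      obtain ⟨s, hs⟩ := hS
      exact ⟨s, hs, fun a ha b hb _ _ => (hT' a ha).trans (hT' b hb).symm⟩
  | @attach K hK x F hF hx ih =>
    have hxF := hx F (mem_faces_of_mem_facesOfCard_succ hF)
    have hc : (insert x F).card = i + 2 := by rw [Finset.card_insert_of_notMem hxF, hF.2]
    have hxK : ∀ n, ∀ s ∈ K.facesOfCard (n + 1), x ∉ s :=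
      fun n s hs => hx s (mem_faces_of_mem_facesOfCard_succ hs)
    have hmem : ∀ n s, s ∈ (K ⊔ fullSimplex (insert x F)).facesOfCard n ↔
        s ∈ K.facesOfCard n ∨ (s ⊆ insert x F ∧ s.card = n) := fun n s => by
      rw [mem_facesOfCard_sup, mem_facesOfCard_fullSimplex]
    -- An `(i+1)`-face is an old one or `F ∪ {x}`.
    have htop : ∀ t ∈ (K ⊔ fullSimplex (insert x F)).facesOfCard (i + 2),
        t ∈ K.facesOfCard (i + 2) ∨ t = insert x F := fun t ht =>
      ((hmem _ _).1 ht).imp_right fun h => Finset.eq_of_subset_of_card_le h.1 (by omega)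
    have hlow : ∀ s ∈ (K ⊔ fullSimplex (insert x F)).facesOfCard (i + 1), x ∉ s →
        s ∈ K.facesOfCard (i + 1) := fun s hs hxs => by
      rcases (hmem _ _).1 hs with h | ⟨h1, h2⟩
      · exact h
      · have := (Finset.subset_insert_iff_of_notMem hxs).1 h1
        rwa [Finset.eq_of_subset_of_card_le this (by rw [hF.2, h2])]
    intro S hS
    by_cases h1 : ∃ s ∈ S, s.card = i + 1 ∧ x ∈ s
    · obtain ⟨s, hs, hsc, hxs⟩ := h1
      have key : ∀ t, ((K ⊔ fullSimplex (insert x F)).incidenceGraph i).Adj s t →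
          t = insert x F := by
        rintro t (⟨_, h2, h3⟩ | ⟨_, h2, _⟩)
        · exact (htop t h2).resolve_left fun h => hxK _ t h (h3 hxs)
        · have := h2.2
          omega
      refine ⟨s, hs, fun a _ b _ ha hb => ?_⟩
      rw [key a ha, key b hb]
    push Not at h1
    by_cases h2 : insert x F ∈ S
    · have key : ∀ t ∈ S, ((K ⊔ fullSimplex (insert x F)).incidenceGraph i).Adj (insert x F) t →
          t = F := by
        rintro t ht (⟨h3, _, _⟩ | ⟨h3, _, h4⟩)
        · have := h3.2
          omega
        · have h5 := (Finset.subset_insert_iff_of_notMem (h1 t ht h3.2)).1 h4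
          exact Finset.eq_of_subset_of_card_le h5 (by rw [hF.2, h3.2])
      refine ⟨_, h2, fun a ha' b hb' ha hb => ?_⟩
      rw [key a ha' ha, key b hb' hb]
    · have key : ∀ s ∈ S, ∀ t ∈ S, ((K ⊔ fullSimplex (insert x F)).incidenceGraph i).Adj s t →
          (K.incidenceGraph i).Adj s t := by
        have aux : ∀ s ∈ S, ∀ t ∈ S, s ∈ (K ⊔ fullSimplex (insert x F)).facesOfCard (i + 1) →
            t ∈ (K ⊔ fullSimplex (insert x F)).facesOfCard (i + 2) →
            s ∈ K.facesOfCard (i + 1) ∧ t ∈ K.facesOfCard (i + 2) := fun s hs t ht hs' ht' =>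
          ⟨hlow s hs' (h1 s hs hs'.2), (htop t ht').resolve_right fun h => h2 (h ▸ ht)⟩
        rintro s hs t ht (⟨h3, h4, h5⟩ | ⟨h3, h4, h5⟩)
        · exact Or.inl ⟨(aux s hs t ht h3 h4).1, (aux s hs t ht h3 h4).2, h5⟩
        · exact Or.inr ⟨(aux t ht s hs h3 h4).1, (aux t ht s hs h3 h4).2, h5⟩
      obtain ⟨v, hv, hv'⟩ := ih S hS
      exact ⟨v, hv, fun a ha b hb hva hvb => hv' a ha b hb (key v hv a ha hva)
        (key v hv b hb hvb)⟩

/-- The incidence signed graph of a stacked complex has no cycles, so it is balanced whatever the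
signs are. -/
lemma IsStacked.isBalanced {i : ℕ} {K : PreAbstractSimplicialComplex V} (h : IsStacked i K)
    (o : K.FaceOrientation) : (K.incidenceSignedGraph i o).IsBalanced := by
  have hac : (K.incidenceSignedGraph i o).graph.IsAcyclic := by
    refine SimpleGraph.IsAcyclic.comap (G' := K.incidenceGraph i)
      ⟨Sum.elim Subtype.val Subtype.val, ?_⟩ ?_
      (SimpleGraph.isAcyclic_of_exists_subsingleton h.exists_subsingleton_adj)
    · rintro a b ⟨-, ⟨F, G, rfl, rfl, hFG⟩ | ⟨F, G, rfl, rfl, hFG⟩⟩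
      · exact Or.inl ⟨F.2, G.2, hFG⟩
      · exact Or.inr ⟨F.2, G.2, hFG⟩
    · -- Faces of the two dimensions are told apart by their cardinalities.
      rintro (⟨a, ha⟩ | ⟨a, ha⟩) (⟨b, hb⟩ | ⟨b, hb⟩) (rfl : a = b)
      · rfl
      · exact absurd (ha.2.symm.trans hb.2) (by omega)
      · exact absurd (ha.2.symm.trans hb.2) (by omega)
      · rfl
  exact fun x c hc => absurd hc (hac c)

/-! ### Iterated wedge sums are stacked -/

lemma map_sup {W : Type*} [DecidableEq W]
    (K L : PreAbstractSimplicialComplex V) (f : V → W) :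
    (K ⊔ L).map f = K.map f ⊔ L.map f :=
  PreAbstractSimplicialComplex.ext (Set.image_union _ _ _)

lemma map_map {W X : Type*} {_ : DecidableEq W} {_ : DecidableEq X}
    (K : PreAbstractSimplicialComplex V) (f : V → W) (g : W → X) :
    (K.map f).map g = K.map (g ∘ f) := by
  refine PreAbstractSimplicialComplex.ext ?_
  simp only [map, Set.image_image, Finset.image_image]

lemma map_fullSimplex {W : Type*} [DecidableEq W] (T : Finset V) (f : V → W) :
    (fullSimplex T).map f = fullSimplex (T.image f) := by
  refine PreAbstractSimplicialComplex.ext (Set.ext fun s => ⟨?_, ?_⟩)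
  · rintro ⟨t, ⟨h1, h2⟩, rfl⟩
    exact ⟨h1.image f, Finset.image_subset_image h2⟩
  · rintro ⟨h1, h2⟩
    obtain ⟨t, ht, rfl⟩ := Finset.subset_image_iff.1 h2
    exact ⟨t, ⟨Finset.image_nonempty.1 h1, ht⟩, rfl⟩

lemma fullSimplex_univ [Fintype V] : fullSimplex (Finset.univ : Finset V) = ⊤ :=
  PreAbstractSimplicialComplex.ext
    (Set.ext fun s => ⟨fun h => h.1, fun h => ⟨h, Finset.subset_univ s⟩⟩)

lemma image_mem_facesOfCard_map {W : Type*} [DecidableEq W]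
    {K : PreAbstractSimplicialComplex V} {f : V → W}
    (hf : Function.Injective f) {n : ℕ} {s : Finset V} (hs : s ∈ K.facesOfCard n) :
    s.image f ∈ (K.map f).facesOfCard n := by
  refine ⟨?_, by rw [Finset.card_image_of_injective _ hf, hs.2]⟩
  rcases hs.1 with rfl | h
  · exact Or.inl (Finset.image_empty f)
  · exact Or.inr ⟨s, h, rfl⟩

open Classical in
lemma IsStacked.map {i : ℕ} {W : Type*} {K : PreAbstractSimplicialComplex V}
    (h : IsStacked i K) {f : V → W} (hf : Function.Injective f) : IsStacked i (K.map f) := by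
  induction h with
  | simplex T hT =>
    rw [map_fullSimplex]
    exact .simplex _ (by rw [Finset.card_image_of_injective _ hf, hT])
  | @attach K hK x F hF hx ih =>
    rw [map_sup, map_fullSimplex, Finset.image_insert]
    refine ih.attach (f x) _ (image_mem_facesOfCard_map hf hF) ?_
    rintro _ ⟨s, hs, rfl⟩ hxs
    obtain ⟨y, hy, hyx⟩ := Finset.mem_image.1 hxs
    exact hx s hs (hf hyx ▸ hy)

/-- The vertex type of a wedge sum with a simplex consists of a copy `j` of the vertices of `K`
and one new vertex `x`; the wedge sum is `K` with the simplex on `F₁ ∪ {x}` attached. -/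
lemma exists_wedgeSum_eq {i : ℕ} (K : PreAbstractSimplicialComplex V) (F₁ : Finset V)
    (F₂ : Finset (Fin (i + 2))) (hF₂ : F₂.card = i + 1) (φ : F₁ ≃ F₂) :
    ∃ (j : V → Quot fun x y : V ⊕ Fin (i + 2) => ∃ v : F₁, x = Sum.inl v.1 ∧ y = Sum.inr (φ v).1)
      (x : _), Function.Injective j ∧ (∀ v, j v ≠ x) ∧ (∀ q, q = x ∨ ∃ v, q = j v) ∧
        open Classical in
        K.wedgeSum ⊤ F₁ F₂ φ = K.map j ⊔ fullSimplex (insert x (F₁.image j)) := by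
  classical
  -- `w₀` is the vertex of the simplex opposite to the facet `F₂`.
  obtain ⟨w₀, hw₀⟩ : ∃ w₀, F₂ᶜ = {w₀} := by
    rw [← Finset.card_eq_one, Finset.card_compl, hF₂, Fintype.card_fin]
    omega
  have hw : ∀ w, w ∉ F₂ ↔ w = w₀ := fun w => by
    rw [← Finset.mem_compl, hw₀, Finset.mem_singleton]
  set r := fun x y : V ⊕ Fin (i + 2) => ∃ v : F₁, x = Sum.inl v.1 ∧ y = Sum.inr (φ v).1
  -- The new vertex goes to `none`, the others to the vertex of `K` they represent.
  let g : Quot r → Option V := Quot.lift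
    (Sum.elim some fun w => if h : w ∈ F₂ then some (φ.symm ⟨w, h⟩).1 else none) (by
      rintro _ _ ⟨v, rfl, rfl⟩
      simp)
  have hj : ∀ w (h : w ∈ F₂), Quot.mk r (Sum.inr w) = Quot.mk r (Sum.inl (φ.symm ⟨w, h⟩).1) :=
    fun w h => (Quot.sound ⟨φ.symm ⟨w, h⟩, rfl, by simp⟩).symm
  refine ⟨fun v => Quot.mk r (Sum.inl v), Quot.mk r (Sum.inr w₀), ?_, ?_, ?_, ?_⟩
  · exact fun a b hab => Option.some_injective _ (congrArg g hab)
  · intro v hv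
    have h : some v = g (Quot.mk r (Sum.inr w₀)) := congrArg g hv
    have h' : g (Quot.mk r (Sum.inr w₀)) = none := dif_neg ((hw w₀).2 rfl)
    rw [h'] at h
    cases h
  · rintro ⟨v | w⟩
    · exact Or.inr ⟨v, rfl⟩
    · by_cases h : w ∈ F₂
      · exact Or.inr ⟨_, hj w h⟩
      · exact Or.inl (by rw [(hw w).1 h])
  · have himage : (Finset.univ.image fun w => Quot.mk r (Sum.inr w)) =
        insert (Quot.mk r (Sum.inr w₀)) (F₁.image fun v => Quot.mk r (Sum.inl v)) := by
      ext q
      simp only [Finset.mem_image, Finset.mem_univ, true_and, Finset.mem_insert]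
      constructor
      · rintro ⟨w, rfl⟩
        by_cases h : w ∈ F₂
        · exact Or.inr ⟨_, (φ.symm ⟨w, h⟩).2, (hj w h).symm⟩
        · exact Or.inl (by rw [(hw w).1 h])
      · rintro (rfl | ⟨v, hv, rfl⟩)
        · exact ⟨w₀, rfl⟩
        · exact ⟨_, (Quot.sound ⟨⟨v, hv⟩, rfl, rfl⟩).symm⟩
    have h1 : K.wedgeSum ⊤ F₁ F₂ φ = K.map (fun v => Quot.mk r (Sum.inl v)) ⊔
        (fullSimplex Finset.univ).map (fun w => Quot.mk r (Sum.inr w)) := by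
      rw [wedgeSum, map_sup, map_map, map_map, fullSimplex_univ]
      rfl
    rw [h1, map_fullSimplex]
    convert rfl using 3
    convert himage.symm

/-- An iterated wedge sum is stacked, and every wedge adds exactly one vertex; hence complexes with
different `p` have different numbers of vertices. -/
lemma IsIteratedWedge.isStacked_and_card {i p : ℕ} {V : Type} {K : PreAbstractSimplicialComplex V}
    (h : K.IsIteratedWedge i p) :
    IsStacked i K ∧ Finite V ∧ Nat.card V = i + 2 + p ∧ K.vertexSet = Set.univ := by
  classical
  induction h with
  | simplex =>
    refine ⟨?_, inferInstance, by simp, Set.eq_univ_of_forall fun v => Finset.singleton_nonempty v⟩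
    rw [← fullSimplex_univ]
    exact .simplex _ (by simp)
  | @wedge p V K hK F₁ F₂ hF₁ hF₂ φ ih =>
    obtain ⟨hs, hfin, hcard, hvert⟩ := ih
    obtain ⟨j, x, hj, hjx, hq, heq⟩ := exists_wedgeSum_eq K F₁ F₂ hF₂.2 φ
    have hbij : Function.Bijective (fun o : Option V => o.elim x j) := by
      constructor
      · rintro (_ | a) (_ | b) hab
        · rfl
        · exact absurd hab.symm (hjx b)
        · exact absurd hab (hjx a)
        · exact congrArg some (hj hab)
      · intro q
        rcases hq q with rfl | ⟨v, rfl⟩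
        · exact ⟨none, rfl⟩
        · exact ⟨some v, rfl⟩
    refine ⟨?_, Finite.of_surjective _ hbij.2, ?_, ?_⟩
    · rw [heq]
      refine (hs.map hj).attach x _ (image_mem_facesOfCard_map hj hF₁) ?_
      rintro _ ⟨s, -, rfl⟩ hxs
      obtain ⟨v, -, hv⟩ := Finset.mem_image.1 hxs
      exact hjx v hv
    · rw [← Nat.card_congr (Equiv.ofBijective _ hbij), Finite.card_option, hcard]
      ring
    · rw [heq]
      refine Set.eq_univ_of_forall fun q => ?_
      rcases hq q with rfl | ⟨v, rfl⟩
      · exact Or.inr ⟨Finset.singleton_nonempty _, by simp⟩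
      · refine Or.inl ⟨{v}, ?_, Finset.image_singleton _ _⟩
        have : v ∈ K.vertexSet := hvert ▸ Set.mem_univ v
        exact this

/-- For every `p` there is an iterated wedge sum `K_p`, since a stacked complex has an
`i`-face to attach along. -/
lemma exists_isIteratedWedge (i p : ℕ) :
    ∃ (V : Type) (K : PreAbstractSimplicialComplex V), K.IsIteratedWedge i p := by
  induction p with
  | zero => exact ⟨_, _, .simplex⟩
  | succ p ih =>
    obtain ⟨V, K, hK⟩ := ih
    have hface : ∀ {W : Type} {L : PreAbstractSimplicialComplex W}, IsStacked i L →
        ∃ F, F ∈ L.facesOfCard (i + 1) := by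
      intro W L hL
      induction hL with
      | simplex T hT =>
        obtain ⟨F, hF, hc⟩ := Finset.exists_subset_card_eq (by omega : i + 1 ≤ T.card)
        exact ⟨F, mem_facesOfCard_fullSimplex.2 ⟨hF, hc⟩⟩
      | attach hK x F hF hx ih => exact ⟨F, mem_facesOfCard_sup.2 (Or.inl hF)⟩
    obtain ⟨F₁, hF₁⟩ := hface hK.isStacked_and_card.1
    obtain ⟨F₂, hF₂⟩ := hface (IsIteratedWedge.simplex (i := i)).isStacked_and_card.1
    exact ⟨_, _, hK.wedge F₁ F₂ hF₁ hF₂ (Finset.equivOfCardEq (hF₁.2.trans hF₂.2.symm))⟩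

lemma Isomorphic.card_eq {W : Type*} {K : PreAbstractSimplicialComplex V}
    {L : PreAbstractSimplicialComplex W} (h : K.Isomorphic L) (hK : K.vertexSet = Set.univ)
    (hL : L.vertexSet = Set.univ) : Nat.card V = Nat.card W := by
  obtain ⟨e, -⟩ := h
  rw [← Nat.card_univ, ← hK, ← Nat.card_univ (α := W), ← hL]
  exact Nat.card_congr e

end PreAbstractSimplicialComplex

theorem mainTheorem7 (i : ℕ) :
    (∀ (p : ℕ) (V : Type) (K : PreAbstractSimplicialComplex V), K.IsIteratedWedge i p →
      Finite V ∧ K.FacePathConnected (i + 1) ∧ K.IsAcyclic ∧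
        ∀ o : K.FaceOrientation, (K.incidenceSignedGraph i o).IsBalanced) ∧
    ∃ (V : ℕ → Type) (K : ∀ p, PreAbstractSimplicialComplex (V p)),
      (∀ p, (K p).IsIteratedWedge i p) ∧ Pairwise fun p q => ¬ (K p).Isomorphic (K q) := by
  constructor
  · intro p V K hK
    obtain ⟨hs, hfin, -, -⟩ := hK.isStacked_and_card
    exact ⟨hfin, PreAbstractSimplicialComplex.facePathConnected_of_reachable hs.reachable,
      hs.isAcyclic, hs.isBalanced⟩
  · choose V K hK using PreAbstractSimplicialComplex.exists_isIteratedWedge i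
    refine ⟨V, K, hK, fun p q hpq h => hpq ?_⟩
    obtain ⟨-, -, hp, hp'⟩ := (hK p).isStacked_and_card
    obtain ⟨-, -, hq, hq'⟩ := (hK q).isStacked_and_card
    have := h.card_eq hp' hq'
    omega
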